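/- Conventions. The Hilbert space of $n$ Bosonic modes is $\mathcal H_n=L^2(\mathbb R^n)$, with phase space $\mathbb R^{2n}\ni\xi=(q,p)$, symplectic form $\sigma((q,p),(q',p'))=q\cdot p'-p\cdot q'$, displacement operators $(D(q,p)\psi)(x)=e^{i(p\cdot x-p\cdot q/2)}\psi(x-q)$ and characteristic functions $\chi(\xi;T)=\mathrm{Tr}[T\,D(\xi)]$ for trace class $T$. For a system of $n$ and an environment of $m$ modes put $D(\xi_1,\xi_2)=D(\xi_1)\otimes D(\xi_2)$ on $\mathcal H_n\otimes\mathcal H_m$, and let $\sigma$ also denote the sum of the two symplectic forms on $\mathbb R^{2n}\oplus\mathbb R^{2m}$. A unitary $U$ on $\mathcal H_n\otimes\mathcal H_m$ is Gaussian, with symplectic matrix $S$ and displacement $d$, if $U^\dagger D(\xi)U=e^{i\sigma(d,\xi)}D(S^{-1}\xi)$ for all $\xi\in\mathbb R^{2n}\oplus\mathbb R^{2m}$; write $S^{-1}=\begin{pmatrix}S_{11}&S_{12}\\S_{21}&S_{22}\end{pmatrix}$ in blocks. A state is a positive operator of trace one; a channel is a completely positive trace-preserving linear map on the trace class operators. A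 linear map $\Phi$ on the trace class operators of $\mathcal H_n$ is - Gaussian dilatable if there are $m$, a Gaussian unitary $U$ on $\mathcal H_n\otimes\mathcal H_m$ and a (possibly non-Gaussian) state $\rho_E$ on $\mathcal H_m$ such that $\Phi[T]=\mathrm{Tr}_E[U(T\otimes\rho_E)U^\dagger]$ for all trace class $T$; - a photon-added Gaussian channel if it has such a dilation in which $\rho_E$ is photon-added Gaussian, that is, $\rho_E=c\,(a^\dagger)^{k}\rho_G\,a^{k}$ with a Gaussian state $\rho_G$ on $\mathcal H_m$ (for instance the vacuum, which gives a Fock state), a multi-index $k\in\mathbb N^m$ of numbers of added photons, $a^k=\prod_j a_j^{k_j}$, and a normalisation constant $c>0$; - a linear Bosonic channel if it is a channel and there are a linear map $X$ on $\mathbb R^{2n}$ and a function $f:\mathbb R^{2n}\to\mathbb C$ such that its adjoint $\Phi^\dagger$ satisfies $\Phi^\dagger[D(\xi)]=f(\xi)\,D(X\xi)$ for all $\xi$. Proposition. Let $n\ge 0$. (1) Let $U$ be a Gaussian unitary on $\mathcal H_n\otimes\mathcal H_m$ with symplectic matrix $S$ and no displacement ($d=0$), and let $\rho_E$ be an arbitrary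 state on $\mathcal H_m$. Then $\Phi[T]=\mathrm{Tr}_E[U(T\otimes\rho_E)U^\dagger]$ defines a linear map on the trace class operators of $\mathcal H_n$; for every input state $\rho_{\mathrm{in}}$, with $\rho_{\mathrm{out}}=\Phi[\rho_{\mathrm{in}}]$, and every $\xi\in\mathbb R^{2n}$, $$\chi(\xi;\rho_{\mathrm{out}})=\chi(S_{11}\xi;\rho_{\mathrm{in}})\,\chi(S_{21}\xi;\rho_E);$$ and $\Phi$ is a linear Bosonic channel with $X=S_{11}$ and $f(\xi)=\chi(S_{21}\xi;\rho_E)$. (2) Every Gaussian dilatable map (displacements allowed) is a linear Bosonic channel; in particular it is completely positive and trace preserving. (3) Every photon-added Gaussian channel is Gaussian dilatable, and hence a linear Bosonic channel. -/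

import Mathlib

open MeasureTheory UniformSpace
open scoped TensorProduct InnerProductSpace ComplexOrder LineDeriv SchwartzMap

noncomputable section

namespace Bosonic

/-! ## Trace class operators, trace, states, Hilbert tensor products, partial trace -/

section Hilbert

variable {H : Type*} [NormedAddCommGroup H] [InnerProductSpace ℂ H]

/-- An operator on a Hilbert space is trace class (equivalently, nuclear) when it is a series
`v ↦ ∑ₖ ⟪yₖ, v⟫ xₖ` of rank-one operators with `∑ₖ ‖xₖ‖ ‖yₖ‖ < ∞`. -/
def IsTraceClass (T : H →L[ℂ] H) : Prop :=
  ∃ x y : ℕ → H, Summable (fun k => ‖x k‖ * ‖y k‖) ∧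
    ∀ v : H, HasSum (fun k => ⟪y k, v⟫_ℂ • x k) (T v)

theorem IsTraceClass.zero : IsTraceClass (0 : H →L[ℂ] H) :=
  ⟨0, 0, by simp, fun v => by simp⟩

theorem IsTraceClass.add {S T : H →L[ℂ] H} (hS : IsTraceClass S) (hT : IsTraceClass T) :
    IsTraceClass (S + T) := by
  obtain ⟨x, y, h1, h2⟩ := hS
  obtain ⟨x', y', h1', h2'⟩ := hT
  obtain ⟨e⟩ : Nonempty (ℕ ⊕ ℕ ≃ ℕ) := ⟨Equiv.natSumNatEquivNat⟩
  refine ⟨fun k => Sum.elim x x' (e.symm k), fun k => Sum.elim y y' (e.symm k), ?_, fun v => ?_⟩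
  · rw [← e.summable_iff]
    refine (HasSum.sum (f := fun s => ‖Sum.elim x x' s‖ * ‖Sum.elim y y' s‖)
      (a := ∑' k, ‖x k‖ * ‖y k‖) (b := ∑' k, ‖x' k‖ * ‖y' k‖) ?_ ?_).summable.congr ?_
    · exact h1.hasSum
    · exact h1'.hasSum
    · intro s; simp
  · rw [← e.hasSum_iff]
    have := HasSum.sum (f := fun s => ⟪Sum.elim y y' s, v⟫_ℂ • Sum.elim x x' s)
      (a := S v) (b := T v) (h2 v) (h2' v)
    convert this using 1
    · ext s; simp
    · rfl

theorem IsTraceClass.smul (c : ℂ) {T : H →L[ℂ] H} (hT : IsTraceClass T) :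
    IsTraceClass (c • T) := by
  obtain ⟨x, y, h1, h2⟩ := hT
  refine ⟨fun k => c • x k, y, ?_, fun v => ?_⟩
  · simpa [norm_smul, mul_assoc] using h1.mul_left ‖c‖
  · simpa [smul_comm c] using (h2 v).const_smul c

variable (H) in
/-- The space of trace class operators on `H`. -/
def traceClass : Submodule ℂ (H →L[ℂ] H) where
  carrier := {T | IsTraceClass T}
  zero_mem' := IsTraceClass.zero
  add_mem' := IsTraceClass.add
  smul_mem' c _ hT := IsTraceClass.smul c hT

variable [CompleteSpace H]

variable (H) in
/-- The index set of a fixed orthonormal (Hilbert) basis of `H`. -/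
def basisIndex : Set H := (exists_hilbertBasis ℂ H).choose

variable (H) in
/-- A fixed orthonormal (Hilbert) basis of `H`. -/
def stdBasis : HilbertBasis (basisIndex H) ℂ H :=
  (exists_hilbertBasis ℂ H).choose_spec.choose

/-- The trace `∑ᵢ ⟪bᵢ, T bᵢ⟫`; on trace class operators the sum converges absolutely and does not
depend on the orthonormal basis. -/
def trace (T : H →L[ℂ] H) : ℂ := ∑' i, ⟪stdBasis H i, T (stdBasis H i)⟫_ℂ

/-- Density operators (quantum states): positive trace class operators of trace one. -/
def IsState (ρ : traceClass H) : Prop :=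
  (ρ : H →L[ℂ] H).IsPositive ∧ trace (ρ : H →L[ℂ] H) = 1

/-- Trace preservation. -/
def IsTracePreserving (Φ : traceClass H →ₗ[ℂ] traceClass H) : Prop :=
  ∀ T : traceClass H, trace (Φ T : H →L[ℂ] H) = trace (T : H →L[ℂ] H)

/-- Complete positivity: for every `d`, the map `id ⊗ Φ`, which acts entrywise on `d × d` block
operators with trace class entries, preserves positivity. -/
def IsCompletelyPositive (Φ : traceClass H →ₗ[ℂ] traceClass H) : Prop :=
  ∀ (d : ℕ) (T : Fin d → Fin d → traceClass H),
    (∀ v : Fin d → H, 0 ≤ ∑ i, ∑ j, ⟪v i, (T i j : H →L[ℂ] H) (v j)⟫_ℂ) →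
    ∀ v : Fin d → H, 0 ≤ ∑ i, ∑ j, ⟪v i, (Φ (T i j) : H →L[ℂ] H) (v j)⟫_ℂ

/-- A quantum channel: a completely positive trace-preserving map. -/
def IsChannel (Φ : traceClass H →ₗ[ℂ] traceClass H) : Prop :=
  IsCompletelyPositive Φ ∧ IsTracePreserving Φ

/-- `Ψ` is the adjoint `Φ†` of `Φ` (Heisenberg picture): `Tr[Φ(T) A] = Tr[T Φ†(A)]`. -/
def IsAdjointMap (Φ : traceClass H →ₗ[ℂ] traceClass H)
    (Ψ : (H →L[ℂ] H) →ₗ[ℂ] (H →L[ℂ] H)) : Prop :=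
  ∀ (T : traceClass H) (A : H →L[ℂ] H),
    trace ((Φ T : H →L[ℂ] H) ∘L A) = trace ((T : H →L[ℂ] H) ∘L Ψ A)

variable {E : Type*} [NormedAddCommGroup E] [InnerProductSpace ℂ E] [CompleteSpace E]

variable (H E) in
/-- The Hilbert space tensor product: the completion of the algebraic one. -/
abbrev HilbertTensor : Type _ := Completion (H ⊗[ℂ] E)

/-- The operator `A ⊗ B` on the Hilbert space tensor product. -/
def tensorOp (A : H →L[ℂ] H) (B : E →L[ℂ] E) : HilbertTensor H E →L[ℂ] HilbertTensor H E :=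
  (TensorProduct.mapL A B).completion

/-- The map `ψ ↦ ψ ⊗ φ`, that is, `1 ⊗ |φ⟩`. -/
def insertKet (φ : E) : H →L[ℂ] HilbertTensor H E :=
  (Completion.toComplL (𝕜 := ℂ) (E := H ⊗[ℂ] E)) ∘L ((TensorProduct.mkL ℂ H E).flip φ)

/-- The partial trace over the second factor, `∑ₖ ⟨k| T |k⟩` for an orthonormal basis `|k⟩` of the
second factor; on trace class operators the series converges absolutely in operator norm and does
not depend on the basis. -/
def partialTrace (T : HilbertTensor H E →L[ℂ] HilbertTensor H E) : H →L[ℂ] H :=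
  ∑' k, (insertKet (H := H) (stdBasis E k)).adjoint ∘L T ∘L insertKet (stdBasis E k)

/-- The unitary operator `U` as a bounded operator. -/
def unitaryOp (U : H ≃ₗᵢ[ℂ] H) : H →L[ℂ] H := (U.toContinuousLinearEquiv : H →L[ℂ] H)

/-- `Φ` is the map `Φ[T] = Tr_E [U (T ⊗ ρE) U†]`. -/
def IsDilation (U : HilbertTensor H E ≃ₗᵢ[ℂ] HilbertTensor H E) (ρE : traceClass E)
    (Φ : traceClass H →ₗ[ℂ] traceClass H) : Prop :=
  ∀ T : traceClass H, (Φ T : H →L[ℂ] H) =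
    partialTrace (unitaryOp U ∘L tensorOp (T : H →L[ℂ] H) (ρE : E →L[ℂ] E) ∘L
      (unitaryOp U).adjoint)

end Hilbert

/-! ## Bosonic modes: phase space, displacement operators, characteristic functions -/

/-- The phase space of `n` modes; a point is `ξ = (q, p)`. -/
abbrev Phase (n : ℕ) : Type := (Fin n → ℝ) × (Fin n → ℝ)

/-- The symplectic form `σ((q, p), (q', p')) = q · p' - p · q'`. -/
def sympl {n : ℕ} (ξ η : Phase n) : ℝ := ∑ j, (ξ.1 j * η.2 j - ξ.2 j * η.1 j)

/-- The symplectic form on the phase space of a bipartite system. -/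
def sympl₂ {n m : ℕ} (ξ η : Phase n × Phase m) : ℝ := sympl ξ.1 η.1 + sympl ξ.2 η.2

/-- The Hilbert space of `n` modes, `L²(ℝⁿ)` (Schrödinger representation). -/
abbrev Modes (n : ℕ) : Type := Lp ℂ 2 (volume : Measure (Fin n → ℝ))

/-- The phase factor `exp(i (p · x - p · q / 2))`. -/
def weylPhase {n : ℕ} (ξ : Phase n) (x : Fin n → ℝ) : ℂ :=
  Complex.exp (((∑ j, (ξ.2 j * x j - ξ.2 j * ξ.1 j / 2) : ℝ) : ℂ) * Complex.I)

theorem norm_weylPhase {n : ℕ} (ξ : Phase n) (x : Fin n → ℝ) : ‖weylPhase ξ x‖ = 1 :=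
  Complex.norm_exp_ofReal_mul_I _

theorem continuous_weylPhase {n : ℕ} (ξ : Phase n) : Continuous (weylPhase ξ) := by
  unfold weylPhase
  fun_prop

theorem memLp_weylPhase_mul {n : ℕ} (ξ : Phase n) (ψ : Modes n) :
    MemLp (fun x => weylPhase ξ x * ψ x) 2 (volume : Measure (Fin n → ℝ)) :=
  (Lp.memLp ψ).of_le ((continuous_weylPhase ξ).aestronglyMeasurable.mul
    (Lp.aestronglyMeasurable ψ)) (Filter.Eventually.of_forall fun x => by simp [norm_weylPhase])

/-- Multiplication by the phase factor, an isometry of `L²(ℝⁿ)`. -/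
def mulPhase {n : ℕ} (ξ : Phase n) : Modes n →ₗᵢ[ℂ] Modes n where
  toFun ψ := (memLp_weylPhase_mul ξ ψ).toLp _
  map_add' ψ φ := by
    rw [← MemLp.toLp_add]
    refine MemLp.toLp_congr _ _ ?_
    filter_upwards [Lp.coeFn_add ψ φ] with x hx
    change weylPhase ξ x * (ψ + φ : Modes n) x = weylPhase ξ x * ψ x + weylPhase ξ x * φ x
    rw [hx, Pi.add_apply, mul_add]
  map_smul' c ψ := by
    rw [RingHom.id_apply, ← MemLp.toLp_const_smul]
    refine MemLp.toLp_congr _ _ ?_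
    filter_upwards [Lp.coeFn_smul c ψ] with x hx
    simp [hx, mul_left_comm]
  norm_map' ψ := by
    change ‖(memLp_weylPhase_mul ξ ψ).toLp _‖ = ‖ψ‖
    rw [Lp.norm_toLp, Lp.norm_def]
    congr 1
    exact eLpNorm_congr_norm_ae (Filter.Eventually.of_forall fun x => by simp [norm_weylPhase])

/-- The displacement (Weyl) operator `D(q, p) = exp(i (p · x̂ - q · p̂))`, that is,
`(D(q, p) ψ)(x) = exp(i (p · x - p · q / 2)) ψ(x - q)`. -/
def displacement {n : ℕ} (ξ : Phase n) : Modes n →L[ℂ] Modes n :=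
  (mulPhase ξ).toContinuousLinearMap ∘L
    (Lp.compMeasurePreservingₗᵢ ℂ (fun x : Fin n → ℝ => x - ξ.1)
      (measurePreserving_sub_right volume ξ.1)).toContinuousLinearMap

theorem displacement_apply_ae {n : ℕ} (ξ : Phase n) (ψ : Modes n) :
    displacement ξ ψ =ᵐ[volume] fun x => weylPhase ξ x * ψ (x - ξ.1) := by
  have hmp := measurePreserving_sub_right (volume : Measure (Fin n → ℝ)) ξ.1
  have h1 := Lp.coeFn_compMeasurePreserving ψ hmp
  have h2 := MemLp.coeFn_toLp (memLp_weylPhase_mul ξ (Lp.compMeasurePreserving _ hmp ψ))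
  filter_upwards [h1, h2] with x hx1 hx2
  exact hx2.trans (by rw [hx1]; rfl)

/-- The characteristic function `χ(ξ; T) = Tr[T D(ξ)]`. -/
def charFn {n : ℕ} (ξ : Phase n) (T : traceClass (Modes n)) : ℂ :=
  trace ((T : Modes n →L[ℂ] Modes n) ∘L displacement ξ)

/-! ## Gaussian unitaries and Gaussian dilatable channels -/

/-- The displacement operator `D(ξ₁, ξ₂) = D(ξ₁) ⊗ D(ξ₂)` of system and environment. -/
def displacement₂ {n m : ℕ} (ξ : Phase n × Phase m) :
    HilbertTensor (Modes n) (Modes m) →L[ℂ] HilbertTensor (Modes n) (Modes m) :=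
  tensorOp (displacement ξ.1) (displacement ξ.2)

/-- Linear symplectic transformations of the phase space of system and environment. -/
def IsSymplectic {n m : ℕ} (S : (Phase n × Phase m) ≃ₗ[ℝ] (Phase n × Phase m)) : Prop :=
  ∀ ξ η, sympl₂ (S ξ) (S η) = sympl₂ ξ η

/-- `U` is a Gaussian unitary which acts on the quadrature operators as the affine symplectic map
with linear part `S` and displacement `d`: `U† D(ξ) U = exp(i σ(d, ξ)) D(S⁻¹ ξ)` for all `ξ`. -/
def IsGaussianUnitary {n m : ℕ}
    (U : HilbertTensor (Modes n) (Modes m) ≃ₗᵢ[ℂ] HilbertTensor (Modes n) (Modes m))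
    (S : (Phase n × Phase m) ≃ₗ[ℝ] (Phase n × Phase m)) (d : Phase n × Phase m) : Prop :=
  IsSymplectic S ∧ ∀ ξ,
    (unitaryOp U).adjoint ∘L displacement₂ ξ ∘L unitaryOp U =
      Complex.exp ((sympl₂ d ξ : ℂ) * Complex.I) • displacement₂ (S.symm ξ)

/-- The block `S₁₁` (system to system) of `S⁻¹`. -/
def block₁₁ {n m : ℕ} (S : (Phase n × Phase m) ≃ₗ[ℝ] (Phase n × Phase m)) :
    Phase n →ₗ[ℝ] Phase n :=
  LinearMap.fst ℝ (Phase n) (Phase m) ∘ₗ S.symm.toLinearMap ∘ₗ LinearMap.inl ℝ (Phase n) (Phase m)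

/-- The block `S₂₁` (system to environment) of `S⁻¹`. -/
def block₂₁ {n m : ℕ} (S : (Phase n × Phase m) ≃ₗ[ℝ] (Phase n × Phase m)) :
    Phase n →ₗ[ℝ] Phase m :=
  LinearMap.snd ℝ (Phase n) (Phase m) ∘ₗ S.symm.toLinearMap ∘ₗ LinearMap.inl ℝ (Phase n) (Phase m)

/-- `Φ` has a dilation with a Gaussian unitary and an arbitrary state of an environment of finitely
many modes. -/
def IsGaussianDilatable {n : ℕ} (Φ : traceClass (Modes n) →ₗ[ℂ] traceClass (Modes n)) : Prop :=
  ∃ (m : ℕ) (U : HilbertTensor (Modes n) (Modes m) ≃ₗᵢ[ℂ] HilbertTensor (Modes n) (Modes m))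
    (S : (Phase n × Phase m) ≃ₗ[ℝ] (Phase n × Phase m)) (d : Phase n × Phase m)
    (ρE : traceClass (Modes m)),
    IsGaussianUnitary U S d ∧ IsState ρE ∧ IsDilation U ρE Φ

/-! ## Linear Bosonic channels -/

/-- `Φ` is a channel with `Φ†[D(ξ)] = f(ξ) D(X ξ)` for all `ξ`. -/
def IsLinearBosonicWith {n : ℕ} (Φ : traceClass (Modes n) →ₗ[ℂ] traceClass (Modes n))
    (X : Phase n →ₗ[ℝ] Phase n) (f : Phase n → ℂ) : Prop :=
  IsChannel Φ ∧
    ∃ Ψ : (Modes n →L[ℂ] Modes n) →ₗ[ℂ] (Modes n →L[ℂ] Modes n),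
      IsAdjointMap Φ Ψ ∧ ∀ ξ, Ψ (displacement ξ) = f ξ • displacement (X ξ)

/-- Linear Bosonic channels. -/
def IsLinearBosonic {n : ℕ} (Φ : traceClass (Modes n) →ₗ[ℂ] traceClass (Modes n)) : Prop :=
  ∃ (X : Phase n →ₗ[ℝ] Phase n) (f : Phase n → ℂ), IsLinearBosonicWith Φ X f

/-! ## Photon addition -/

/-- Gaussian states: the characteristic function is `exp(i ℓ(ξ) - V(ξ, ξ) / 2)` with a linear form
`ℓ` and a real bilinear form `V`. -/
def IsGaussianState {m : ℕ} (ρ : traceClass (Modes m)) : Prop :=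
  IsState ρ ∧ ∃ (l : Phase m →ₗ[ℝ] ℝ) (V : LinearMap.BilinForm ℝ (Phase m)),
    ∀ ξ, charFn ξ ρ = Complex.exp ((l ξ : ℂ) * Complex.I - (V ξ ξ : ℂ) / 2)

/-- The annihilation operator `a_j = (x_j + ∂_j) / √2` of mode `j` on Schwartz functions. -/
def annihilation {m : ℕ} (j : Fin m) : Module.End ℂ 𝓢(Fin m → ℝ, ℂ) :=
  ((√2 : ℝ) : ℂ)⁻¹ •
    ((SchwartzMap.smulLeftCLM ℂ (fun x : Fin m → ℝ => (x j : ℂ))).toLinearMap +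
      (LineDeriv.lineDerivOpCLM ℂ 𝓢(Fin m → ℝ, ℂ) (Pi.single j (1 : ℝ) : Fin m → ℝ)).toLinearMap)

theorem annihilation_apply {m : ℕ} (j : Fin m) (φ : 𝓢(Fin m → ℝ, ℂ)) (x : Fin m → ℝ) :
    annihilation j φ x = ((√2 : ℝ) : ℂ)⁻¹ *
      ((x j : ℂ) * φ x + lineDeriv ℝ φ x (Pi.single j 1)) := by
  have hg : Function.HasTemperateGrowth (fun x : Fin m → ℝ => (x j : ℂ)) :=
    (Complex.ofRealCLM ∘L
      (ContinuousLinearMap.proj j : (Fin m → ℝ) →L[ℝ] ℝ)).hasTemperateGrowth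
  simp [annihilation, SchwartzMap.smulLeftCLM_apply_apply hg, SchwartzMap.lineDerivOp_apply,
    mul_add]

/-- `∏ⱼ a_j ^ (k j)`. -/
def annihilationPow {m : ℕ} (k : Fin m → ℕ) : Module.End ℂ 𝓢(Fin m → ℝ, ℂ) :=
  ((List.finRange m).map fun j => annihilation j ^ k j).prod

/-- `ρ` is obtained from a Gaussian state `ρG` by adding `k j` photons to every mode `j`:
`ρ = c (a†)ᵏ ρG aᵏ` with a normalisation constant `c > 0`. The identity of operators is tested on
the Schwartz functions, which are dense in `L²` and lie in the domain of `aᵏ`. For the vacuum `ρG`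
this is the Fock state `|k⟩⟨k|`, for a thermal state it is a photon-added thermal state. -/
def IsPhotonAddedGaussianState {m : ℕ} (ρ : traceClass (Modes m)) : Prop :=
  IsState ρ ∧ ∃ (ρG : traceClass (Modes m)) (k : Fin m → ℕ) (c : ℝ), IsGaussianState ρG ∧ 0 < c ∧
    ∀ φ φ' : 𝓢(Fin m → ℝ, ℂ),
      ⟪φ.toLp 2, (ρ : Modes m →L[ℂ] Modes m) (φ'.toLp 2)⟫_ℂ =
        (c : ℂ) * ⟪(annihilationPow k φ).toLp 2,
          (ρG : Modes m →L[ℂ] Modes m) ((annihilationPow k φ').toLp 2)⟫_ℂ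

/-- Photon-added Gaussian channels: a Gaussian unitary couples the system to an environment whose
Gaussian state has undergone photon addition. -/
def IsPhotonAddedGaussianChannel {n : ℕ}
    (Φ : traceClass (Modes n) →ₗ[ℂ] traceClass (Modes n)) : Prop :=
  ∃ (m : ℕ) (U : HilbertTensor (Modes n) (Modes m) ≃ₗᵢ[ℂ] HilbertTensor (Modes n) (Modes m))
    (S : (Phase n × Phase m) ≃ₗ[ℝ] (Phase n × Phase m)) (d : Phase n × Phase m)
    (ρE : traceClass (Modes m)),
    IsGaussianUnitary U S d ∧ IsPhotonAddedGaussianState ρE ∧ IsDilation U ρE Φ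

end Bosonic

end

/-! The argument runs in the Heisenberg picture. The adjoint of `Φ` is `Ψ(A) = Tr_E[(1 ⊗ ρE) U†(A ⊗
1)U]`, and whenever `U†(A ⊗ 1)U = c • (A' ⊗ C)` this collapses to `Ψ(A) = c Tr[ρE C] A'`
(`IsDilation.exists_isAdjointMap`). For `A = D(ξ)` one has `D(ξ) ⊗ 1 = D(ξ, 0)`, which a Gaussian
unitary sends to a phase times `D(S₁₁ξ) ⊗ D(S₂₁ξ)`. Hence `Ψ(D(ξ))` is a multiple of `D(S₁₁ξ)`, and
pairing with an input gives the characteristic function.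

Trace preservation is `Ψ(1) = 1`. Complete positivity comes from factoring `ρE = Q†Q` and slicing
along an orthonormal basis of the environment (`sum_inner_tensorOp_nonneg`).

The analytic content is the exchange of infinite sums. Trace class operators are carried as
absolutely convergent series of `|xₖ⟩⟨yₖ|`, a form stable under conjugation, tensor products and
partial traces. The trace identities then equate two sums of one absolutely summable family; where
slices occur, summability comes from Cauchy–Schwarz and Parseval. -/

namespace Bosonic

/-! ### Nuclear series and the trace -/

section Nuclear

variable {H K : Type*} [NormedAddCommGroup H] [InnerProductSpace ℂ H]
  [NormedAddCommGroup K] [InnerProductSpace ℂ K]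

/-- `T` is the absolutely convergent sum of the rank-one operators `|xₖ⟩⟨yₖ|`, over an arbitrary
index type. -/
def HasNuclearRep {ι : Type*} (T : H →L[ℂ] H) (x y : ι → H) : Prop :=
  Summable (fun k => ‖x k‖ * ‖y k‖) ∧ ∀ v : H, HasSum (fun k => ⟪y k, v⟫_ℂ • x k) (T v)

/-- A summable family has countable support, so the relevant indices inject into `ℕ`; the series is
transported along this injection and padded by zero. This permits product index types such as `ι ×
basisIndex E` below. -/
theorem HasNuclearRep.isTraceClass {ι : Type*} {T : H →L[ℂ] H} {x y : ι → H}
    (h : HasNuclearRep T x y) : IsTraceClass T := by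
  have hc : (Function.support fun k => ‖x k‖ * ‖y k‖).Countable := h.1.countable_support
  obtain ⟨g, hg⟩ := Set.countable_iff_exists_injOn.1 hc
  set s := Function.support fun k => ‖x k‖ * ‖y k‖
  have hinj : Function.Injective (fun k : s => g k) := fun a b hab => Subtype.ext (hg a.2 b.2 hab)
  have h0 : ∀ n, n ∉ Set.range (fun k : s => g k) →
      Function.extend (fun k : s => g k) (fun k => x k) 0 n = 0 := fun n hn =>
    Function.extend_apply' _ _ _ (by simpa [Set.mem_range] using hn)
  refine ⟨Function.extend (fun k : s => g k) (fun k => x k) 0,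
    Function.extend (fun k : s => g k) (fun k => y k) 0, ?_, fun v => ?_⟩
  · refine (hinj.summable_iff fun n hn => by simp [h0 n hn]).1 ?_
    refine (h.1.comp_injective (i := ((↑) : s → ι)) Subtype.val_injective).congr fun k => ?_
    simp [hinj.extend_apply]
  · refine (hinj.hasSum_iff fun n hn => by simp [h0 n hn]).1 ?_
    have hs : Function.support (fun k => ⟪y k, v⟫_ℂ • x k) ⊆ s := by
      intro k hk
      simp only [Function.mem_support, ne_eq, smul_eq_zero, not_or] at hk
      simp only [s, Function.mem_support, ne_eq, mul_eq_zero, norm_eq_zero, not_or]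
      exact ⟨hk.2, fun h0 => hk.1 (by simp [h0])⟩
    refine ((hasSum_subtype_iff_of_support_subset hs).2 (h.2 v)).congr_fun fun k => ?_
    simp [hinj.extend_apply]

/-- Termwise, `A |x⟩⟨y| B = |A x⟩⟨B† y|`. -/
theorem HasNuclearRep.conj [CompleteSpace H] [CompleteSpace K] {ι : Type*} {T : H →L[ℂ] H}
    {x y : ι → H} (h : HasNuclearRep T x y) (A : H →L[ℂ] K) (B : K →L[ℂ] H) :
    HasNuclearRep (A ∘L T ∘L B) (fun k => A (x k)) (fun k => B.adjoint (y k)) := by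
  refine ⟨?_, fun v => ?_⟩
  · refine Summable.of_nonneg_of_le (fun k => by positivity) (fun k => ?_)
      (h.1.mul_left (‖A‖ * ‖B.adjoint‖))
    calc ‖A (x k)‖ * ‖B.adjoint (y k)‖ ≤ (‖A‖ * ‖x k‖) * (‖B.adjoint‖ * ‖y k‖) :=
          mul_le_mul (A.le_opNorm _) (B.adjoint.le_opNorm _) (norm_nonneg _) (by positivity)
      _ = _ := by ring
  · have := (h.2 (B v)).mapL A
    simpa [ContinuousLinearMap.adjoint_inner_left] using this

/-- Cauchy–Schwarz for square summable families, summed over an outer index. -/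
theorem summable_mul_of_hasSum_sq {ι κ : Type*} {f g : ι → κ → ℝ} {F G : ι → ℝ}
    (hf : ∀ i j, 0 ≤ f i j) (hg : ∀ i j, 0 ≤ g i j) (hF : ∀ i, 0 ≤ F i) (hG : ∀ i, 0 ≤ G i)
    (hfF : ∀ i, HasSum (fun j => f i j ^ 2) (F i ^ 2))
    (hgG : ∀ i, HasSum (fun j => g i j ^ 2) (G i ^ 2)) (h : Summable fun i => F i * G i) :
    Summable fun p : ι × κ => f p.1 p.2 * g p.1 p.2 := by
  have key : ∀ i, ∃ C, 0 ≤ C ∧ C ≤ F i * G i ∧ HasSum (fun j => f i j * g i j) C := fun i =>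
    Real.inner_le_Lp_mul_Lq_hasSum_of_nonneg Real.HolderConjugate.two_two (hF i) (hG i) (hf i)
      (hg i) (by simpa using hfF i) (by simpa using hgG i)
  rw [summable_prod_of_nonneg fun p => mul_nonneg (hf _ _) (hg _ _)]
  refine ⟨fun i => (key i).choose_spec.2.2.summable, ?_⟩
  refine Summable.of_nonneg_of_le (fun i => tsum_nonneg fun j => mul_nonneg (hf _ _) (hg _ _))
    (fun i => ?_) h
  rw [(key i).choose_spec.2.2.tsum_eq]
  exact (key i).choose_spec.2.1

theorem hasSum_sq_norm_inner [CompleteSpace H] {ι : Type*} (b : HilbertBasis ι ℂ H) (v : H) :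
    HasSum (fun i => ‖⟪b i, v⟫_ℂ‖ ^ 2) (‖v‖ ^ 2) := by
  have h := Complex.hasSum_re (b.hasSum_inner_mul_inner v v)
  have h2 : (⟪v, v⟫_ℂ).re = ‖v‖ ^ 2 := by
    rw [inner_self_eq_norm_sq_to_K]; norm_cast
  rw [h2] at h
  refine h.congr_fun fun i => ?_
  rw [← inner_conj_symm v (b i), mul_comm, Complex.mul_conj, Complex.normSq_eq_norm_sq,
    Complex.ofReal_re]

/-- The trace of a nuclear operator `∑ₖ |xₖ⟩⟨yₖ|` is `∑ₖ ⟪yₖ, xₖ⟫`. -/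
theorem HasNuclearRep.hasSum_trace [CompleteSpace H] {ι : Type*} {T : H →L[ℂ] H} {x y : ι → H}
    (h : HasNuclearRep T x y) : HasSum (fun k => ⟪y k, x k⟫_ℂ) (trace T) := by
  set b := stdBasis H
  -- Cauchy–Schwarz over the basis index, with Parseval for `x k` and `y k`, bounds the inner sums
  -- by `‖x k‖ * ‖y k‖`. Summing over the basis first gives `⟪y k, x k⟫`; summing over `k` first
  -- gives the diagonal entries of `T`.
  have hs : Summable fun p : ι × basisIndex H => ⟪y p.1, b p.2⟫_ℂ * ⟪b p.2, x p.1⟫_ℂ := by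
    refine Summable.of_norm ?_
    refine (summable_mul_of_hasSum_sq (f := fun k i => ‖⟪b i, x k⟫_ℂ‖)
      (g := fun k i => ‖⟪b i, y k⟫_ℂ‖) (F := fun k => ‖x k‖) (G := fun k => ‖y k‖)
      (fun _ _ => norm_nonneg _) (fun _ _ => norm_nonneg _) (fun _ => norm_nonneg _)
      (fun _ => norm_nonneg _) (fun k => hasSum_sq_norm_inner b _)
      (fun k => hasSum_sq_norm_inner b _) h.1).congr fun p => ?_
    rw [norm_mul, mul_comm, norm_inner_symm (y p.1)]
  have h1 : HasSum (fun k => ⟪y k, x k⟫_ℂ)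
      (∑' p : ι × basisIndex H, ⟪y p.1, b p.2⟫_ℂ * ⟪b p.2, x p.1⟫_ℂ) :=
    hs.hasSum.prod_fiberwise fun k => b.hasSum_inner_mul_inner (y k) (x k)
  have h2 := ((Equiv.prodComm _ _).hasSum_iff.2 hs.hasSum).prod_fiberwise
    (g := fun i => ⟪b i, T (b i)⟫_ℂ) fun i => by
      have := (h.2 (b i)).mapL (innerSL ℂ (b i))
      simpa [inner_smul_right] using this
  rwa [trace, h2.tsum_eq]

theorem HasNuclearRep.hasSum_trace_comp [CompleteSpace H] {ι : Type*} {T : H →L[ℂ] H}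
    {x y : ι → H} (h : HasNuclearRep T x y) (A : H →L[ℂ] H) :
    HasSum (fun k => ⟪y k, A (x k)⟫_ℂ) (trace (T ∘L A)) := by
  have := (h.conj (.id ℂ H) A).hasSum_trace
  simpa [ContinuousLinearMap.adjoint_inner_left] using this

/-- Cyclicity of the trace, between two spaces. -/
theorem trace_conj_comp [CompleteSpace H] [CompleteSpace K] {T : H →L[ℂ] H} (hT : IsTraceClass T)
    (A : H →L[ℂ] K) (B : K →L[ℂ] H) (C : K →L[ℂ] K) :
    trace ((A ∘L T ∘L B) ∘L C) = trace (T ∘L (B ∘L C ∘L A)) := by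
  obtain ⟨x, y, h⟩ := hT
  have h : HasNuclearRep T x y := h
  -- Both traces equal `∑ₖ ⟪yₖ, B C A xₖ⟫`.
  refine ((h.conj A B).hasSum_trace_comp C).unique ?_
  simpa [ContinuousLinearMap.adjoint_inner_left] using h.hasSum_trace_comp (B ∘L C ∘L A)

end Nuclear

end Bosonic

namespace Bosonic

/-! ### Operators on the Hilbert tensor product and slices along a basis -/

section Tensor

variable {H E : Type*} [NormedAddCommGroup H] [InnerProductSpace ℂ H]
  [NormedAddCommGroup E] [InnerProductSpace ℂ E]

theorem insertKet_apply (φ : E) (a : H) :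
    insertKet φ a = ((a ⊗ₜ[ℂ] φ : H ⊗[ℂ] E) : HilbertTensor H E) := rfl

theorem inner_insertKet (φ φ' : E) (a a' : H) :
    ⟪insertKet φ a, insertKet φ' a'⟫_ℂ = ⟪a, a'⟫_ℂ * ⟪φ, φ'⟫_ℂ := by
  simp [insertKet_apply, Completion.inner_coe]

theorem norm_insertKet_apply (φ : E) (a : H) : ‖insertKet φ a‖ = ‖a‖ * ‖φ‖ := by
  simp [insertKet_apply]

theorem norm_insertKet_le (φ : E) : ‖(insertKet φ : H →L[ℂ] HilbertTensor H E)‖ ≤ ‖φ‖ :=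
  ContinuousLinearMap.opNorm_le_bound _ (norm_nonneg _) fun a => by
    rw [norm_insertKet_apply, mul_comm]

theorem tensorOp_insertKet (A : H →L[ℂ] H) (B : E →L[ℂ] E) (φ : E) (a : H) :
    tensorOp A B (insertKet φ a) = insertKet (B φ) (A a) := by
  simp [insertKet_apply, tensorOp, ContinuousLinearMap.completion_apply_coe]

/-- Continuous linear maps on the Hilbert tensor product are determined by product vectors. -/
theorem hilbertTensor_ext {F : Type*} [NormedAddCommGroup F] [NormedSpace ℂ F]
    {A B : HilbertTensor H E →L[ℂ] F}
    (h : ∀ (a : H) (φ : E), A (insertKet φ a) = B (insertKet φ a)) : A = B := by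
  ext z
  induction z using Completion.induction_on with
  | hp => exact isClosed_eq A.continuous B.continuous
  | ih z =>
    induction z using TensorProduct.induction_on with
    | zero => exact (map_zero A).trans (map_zero B).symm
    | tmul a φ => exact h a φ
    | add z w hz hw => simp only [Completion.coe_add, map_add, hz, hw]

theorem tensorOp_comp (A A' : H →L[ℂ] H) (B B' : E →L[ℂ] E) :
    tensorOp A B ∘L tensorOp A' B' = tensorOp (A ∘L A') (B ∘L B') :=
  hilbertTensor_ext fun a φ => by simp [tensorOp_insertKet]

theorem tensorOp_id : tensorOp (.id ℂ H) (.id ℂ E) = .id ℂ (HilbertTensor H E) :=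
  hilbertTensor_ext fun a φ => by simp [tensorOp_insertKet]

theorem tensorOp_add_left (A A' : H →L[ℂ] H) (B : E →L[ℂ] E) :
    tensorOp (A + A') B = tensorOp A B + tensorOp A' B :=
  hilbertTensor_ext fun a φ => by simp [tensorOp_insertKet]

theorem tensorOp_smul_left (c : ℂ) (A : H →L[ℂ] H) (B : E →L[ℂ] E) :
    tensorOp (c • A) B = c • tensorOp A B :=
  hilbertTensor_ext fun a φ => by simp [tensorOp_insertKet]

/-- Tensor products of nuclear representations. -/
theorem HasNuclearRep.tensorOp {ι κ : Type*} {T : H →L[ℂ] H} {R : E →L[ℂ] E} {x y : ι → H}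
    {u v : κ → E} (hT : HasNuclearRep T x y) (hR : HasNuclearRep R u v) :
    HasNuclearRep (tensorOp T R) (fun p : ι × κ => insertKet (u p.2) (x p.1))
      (fun p : ι × κ => insertKet (v p.2) (y p.1)) := by
  have hs : Summable fun p : ι × κ =>
      ‖insertKet (u p.2) (x p.1)‖ * ‖insertKet (v p.2) (y p.1)‖ := by
    refine (hT.1.mul_of_nonneg hR.1 (fun _ => by positivity) (fun _ => by positivity)).congr
      fun p => ?_
    simp only [norm_insertKet_apply]
    ring
  have hop : Summable fun p : ι × κ => (innerSL ℂ (insertKet (v p.2) (y p.1))).smulRight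
      (insertKet (u p.2) (x p.1)) :=
    Summable.of_norm (hs.congr fun p => by
      rw [ContinuousLinearMap.norm_smulRight_apply, innerSL_apply_norm, mul_comm])
  refine ⟨hs, fun z => ?_⟩
  -- The series converges in operator norm, so its sum is bounded and can be compared with `T ⊗ R`
  -- on product vectors, where the double sum separates.
  have heq : Bosonic.tensorOp T R = ∑' p : ι × κ,
      (innerSL ℂ (insertKet (v p.2) (y p.1))).smulRight (insertKet (u p.2) (x p.1)) := by
    refine hilbertTensor_ext fun a φ => ?_
    have h1 := hop.hasSum.mapL (ContinuousLinearMap.apply ℂ (HilbertTensor H E) (insertKet φ a))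
    rw [ContinuousLinearMap.apply_apply] at h1
    rw [tensorOp_insertKet]
    have h2 := h1.prod_fiberwise (g := fun k => insertKet (R φ) (⟪y k, a⟫_ℂ • x k)) fun k => by
      have := (hR.2 φ).mapL ((Completion.toComplL (𝕜 := ℂ) (E := H ⊗[ℂ] E)) ∘L
        (TensorProduct.mkL ℂ H E (⟪y k, a⟫_ℂ • x k)))
      refine this.congr_fun fun l => ?_
      simp [insertKet_apply, Completion.inner_coe, mul_smul, smul_comm ⟪y k, a⟫_ℂ]
    exact ((hT.2 a).mapL (insertKet (R φ))).unique h2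
  rw [heq]
  simpa using hop.hasSum.mapL (ContinuousLinearMap.apply ℂ (HilbertTensor H E) z)

theorem isTraceClass_tensorOp {T : H →L[ℂ] H} {R : E →L[ℂ] E} (hT : IsTraceClass T)
    (hR : IsTraceClass R) : IsTraceClass (tensorOp T R) := by
  obtain ⟨x, y, hT⟩ := hT
  obtain ⟨u, v, hR⟩ := hR
  exact (HasNuclearRep.tensorOp (x := x) (y := y) (u := u) (v := v) hT hR).isTraceClass

variable [CompleteSpace H]

/-- Resolution of the identity `∑ⱼ (1 ⊗ |j⟩⟨j|) = 1` for an orthonormal basis of the second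
factor. -/
theorem hasSum_insertKet_adjoint {ι : Type*} (b : HilbertBasis ι ℂ E) (z : HilbertTensor H E) :
    HasSum (fun j => insertKet (b j) ((insertKet (H := H) (b j)).adjoint z)) z := by
  classical
  have hb : ∀ i, ‖b i‖ = 1 := fun i => b.orthonormal.1 i
  let V : ι → H →ₗᵢ[ℂ] HilbertTensor H E := fun j =>
    ⟨(insertKet (b j) : H →L[ℂ] HilbertTensor H E).toLinearMap, fun a => by
      change ‖insertKet (b j) a‖ = ‖a‖
      rw [norm_insertKet_apply, hb, mul_one]⟩
  have hV : ∀ j a, V j a = insertKet (b j) a := fun _ _ => rfl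
  have hO : OrthogonalFamily ℂ (fun _ : ι => H) V := by
    intro i j hij a a'
    simp only [hV, inner_insertKet, b.orthonormal.2 hij, mul_zero]
  -- Completeness of the family: a vector orthogonal to every `H ⊗ b i` is orthogonal to `a ⊗ φ`, by
  -- expanding `φ` in the basis, hence to everything.
  have hS : IsHilbertSum ℂ (fun _ : ι => H) V := by
    refine IsHilbertSum.mk hO ?_
    rw [top_le_iff, Submodule.topologicalClosure_eq_top_iff, Submodule.eq_bot_iff]
    intro z hz
    have hz0 : innerSL ℂ z = 0 := by
      refine hilbertTensor_ext fun a φ => ?_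
      have h1 : HasSum (fun i => ⟪z, insertKet (b.repr φ i • b i) a⟫_ℂ) ⟪z, insertKet φ a⟫_ℂ :=
        (b.hasSum_repr φ).mapL ((innerSL ℂ z) ∘L
          (Completion.toComplL (𝕜 := ℂ) (E := H ⊗[ℂ] E)) ∘L (TensorProduct.mkL ℂ H E a))
      have h2 : ∀ i, ⟪z, insertKet (b.repr φ i • b i) a⟫_ℂ = 0 := fun i => by
        have h3 : insertKet (b.repr φ i • b i) a = V i (b.repr φ i • a) := by
          rw [hV, insertKet_apply, insertKet_apply, TensorProduct.tmul_smul,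
            TensorProduct.smul_tmul']
        rw [h3]
        exact Submodule.inner_left_of_mem_orthogonal
          (Submodule.mem_iSup_of_mem i (LinearMap.mem_range_self (V i).toLinearMap _)) hz
      simp only [h2] at h1
      simpa using h1.unique hasSum_zero
    have := congrArg (fun f => f z) hz0
    simpa using this
  obtain ⟨w, rfl⟩ := hS.linearIsometryEquiv.symm.surjective z
  have hw := hS.hasSum_linearIsometryEquiv_symm w
  -- Orthogonality of the summands makes `1 ⊗ ⟨b j|` pick out the `j`-th component.
  have hadj : ∀ j, (insertKet (H := H) (b j)).adjoint (hS.linearIsometryEquiv.symm w) = w j := by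
    intro j
    refine (hw.mapL (insertKet (H := H) (b j)).adjoint).unique ?_
    have hs : ∀ i, (insertKet (H := H) (b j)).adjoint (V i (w i)) = if i = j then w j else 0 := by
      intro i
      refine ext_inner_right ℂ fun a => ?_
      rw [ContinuousLinearMap.adjoint_inner_left, hV, inner_insertKet,
        orthonormal_iff_ite.1 b.orthonormal i j]
      split_ifs with h <;> simp [h]
    simp only [hs]
    exact hasSum_ite_eq j (w j)
  simpa only [hadj, hV] using hw

theorem hasSum_inner_insertKet_adjoint {ι : Type*} (b : HilbertBasis ι ℂ E)
    (z w : HilbertTensor H E) :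
    HasSum (fun j => ⟪(insertKet (H := H) (b j)).adjoint z,
      (insertKet (H := H) (b j)).adjoint w⟫_ℂ) ⟪z, w⟫_ℂ := by
  simpa [ContinuousLinearMap.adjoint_inner_left] using
    (hasSum_insertKet_adjoint b w).mapL (innerSL ℂ z)

theorem hasSum_sq_norm_insertKet_adjoint {ι : Type*} (b : HilbertBasis ι ℂ E)
    (z : HilbertTensor H E) :
    HasSum (fun j => ‖(insertKet (H := H) (b j)).adjoint z‖ ^ 2) (‖z‖ ^ 2) := by
  have h := hasSum_inner_insertKet_adjoint b z z
  simp only [inner_self_eq_norm_sq_to_K] at h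
  exact_mod_cast h

variable [CompleteSpace E]

theorem adjoint_tensorOp (A : H →L[ℂ] H) (B : E →L[ℂ] E) :
    (tensorOp A B).adjoint = tensorOp A.adjoint B.adjoint := by
  refine hilbertTensor_ext fun a φ => ext_inner_right ℂ fun z => ?_
  revert z
  suffices (innerSL ℂ ((tensorOp A B).adjoint (insertKet φ a))) =
      innerSL ℂ (tensorOp A.adjoint B.adjoint (insertKet φ a)) from
    fun z => congrArg (fun f => f z) this
  refine hilbertTensor_ext fun a' φ' => ?_
  simp [ContinuousLinearMap.adjoint_inner_left, tensorOp_insertKet, inner_insertKet]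

/-- Slicing in `E` commutes with operators acting on `H` alone; this is the adjoint of
`tensorOp_insertKet` for `A† ⊗ 1`. -/
theorem adjoint_insertKet_tensorOp (A : H →L[ℂ] H) (φ : E) (z : HilbertTensor H E) :
    (insertKet (H := H) φ).adjoint (tensorOp A (.id ℂ E) z) =
      A ((insertKet (H := H) φ).adjoint z) := by
  refine ext_inner_right ℂ fun a => ?_
  rw [ContinuousLinearMap.adjoint_inner_left, ← ContinuousLinearMap.adjoint_inner_right,
    adjoint_tensorOp, tensorOp_insertKet, ← ContinuousLinearMap.adjoint_inner_right A,
    ContinuousLinearMap.adjoint_inner_left]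
  simp [← ContinuousLinearMap.star_eq_adjoint, ← ContinuousLinearMap.one_def]

end Tensor

end Bosonic

namespace Bosonic

/-! ### Partial trace of nuclear operators -/

section PartialTrace

variable {H E : Type*} [NormedAddCommGroup H] [InnerProductSpace ℂ H] [CompleteSpace H]
  [NormedAddCommGroup E] [InnerProductSpace ℂ E] [CompleteSpace E]

/-- Cauchy–Schwarz over the basis index: the squared norms of the slices of `x k` sum to `‖x k‖ ^
2`, and likewise for `y k`. -/
theorem HasNuclearRep.summable_partialTrace {ι : Type*}
    {M : HilbertTensor H E →L[ℂ] HilbertTensor H E} {x y : ι → HilbertTensor H E}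
    (h : HasNuclearRep M x y) :
    Summable fun p : ι × basisIndex E => ‖(insertKet (H := H) (stdBasis E p.2)).adjoint (x p.1)‖ *
      ‖(insertKet (H := H) (stdBasis E p.2)).adjoint (y p.1)‖ :=
  summable_mul_of_hasSum_sq
    (f := fun k j => ‖(insertKet (H := H) (stdBasis E j)).adjoint (x k)‖)
    (g := fun k j => ‖(insertKet (H := H) (stdBasis E j)).adjoint (y k)‖)
    (fun _ _ => norm_nonneg _) (fun _ _ => norm_nonneg _) (fun _ => norm_nonneg _)
    (fun _ => norm_nonneg _) (fun k => hasSum_sq_norm_insertKet_adjoint _ (x k))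
    (fun k => hasSum_sq_norm_insertKet_adjoint _ (y k)) h.1

/-- The partial trace of a nuclear operator converges, in operator norm. -/
theorem hasSum_partialTrace {M : HilbertTensor H E →L[ℂ] HilbertTensor H E}
    (hM : IsTraceClass M) :
    HasSum (fun j => (insertKet (H := H) (stdBasis E j)).adjoint ∘L M ∘L insertKet (stdBasis E j))
      (partialTrace M) := by
  obtain ⟨x, y, h⟩ := hM
  have h : HasNuclearRep M x y := h
  refine (Summable.of_norm ?_).hasSum
  -- With the basis index outermost, the sum over `k` bounds the norm of the `j`-th term of the
  -- partial trace, and these bounds are summable in `j`.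
  have hs := (Equiv.prodComm (basisIndex E) ℕ).summable_iff.2 h.summable_partialTrace
  refine Summable.of_nonneg_of_le (fun _ => norm_nonneg _) (fun j => ?_) hs.prod
  have hj := hs.prod_factor j
  refine ContinuousLinearMap.opNorm_le_bound _ 
    (tsum_nonneg fun k => mul_nonneg (norm_nonneg _) (norm_nonneg _)) fun v => ?_
  have hv := (h.conj (insertKet (H := H) (stdBasis E j)).adjoint (insertKet (stdBasis E j))).2 v
  rw [← hv.tsum_eq]
  refine tsum_of_norm_bounded (hj.hasSum.mul_right ‖v‖) fun k => ?_
  rw [norm_smul]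
  calc _ ≤ (‖(insertKet (H := H) (stdBasis E j)).adjoint (y k)‖ * ‖v‖) *
        ‖(insertKet (H := H) (stdBasis E j)).adjoint (x k)‖ := by
          gcongr
          exact norm_inner_le_norm _ _
    _ = _ := by
      simp only [Function.comp, Equiv.prodComm_apply, Prod.swap]
      ring

/-- Each term `⟨j| M |j⟩` inherits a nuclear series from `M`; absolute summability over pairs merges
these into one series. -/
theorem HasNuclearRep.partialTrace {ι : Type*}
    {M : HilbertTensor H E →L[ℂ] HilbertTensor H E} {x y : ι → HilbertTensor H E}
    (h : HasNuclearRep M x y) :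
    HasNuclearRep (partialTrace M)
      (fun p : ι × basisIndex E => (insertKet (H := H) (stdBasis E p.2)).adjoint (x p.1))
      (fun p : ι × basisIndex E => (insertKet (H := H) (stdBasis E p.2)).adjoint (y p.1)) := by
  refine ⟨h.summable_partialTrace, fun v => ?_⟩
  have hs : Summable fun p : ι × basisIndex E =>
      ⟪(insertKet (H := H) (stdBasis E p.2)).adjoint (y p.1), v⟫_ℂ •
        (insertKet (H := H) (stdBasis E p.2)).adjoint (x p.1) := by
    refine Summable.of_norm (Summable.of_nonneg_of_le (fun _ => norm_nonneg _) (fun p => ?_)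
      (h.summable_partialTrace.mul_right ‖v‖))
    rw [norm_smul]
    calc _ ≤ (‖(insertKet (H := H) (stdBasis E p.2)).adjoint (y p.1)‖ * ‖v‖) *
          ‖(insertKet (H := H) (stdBasis E p.2)).adjoint (x p.1)‖ := by
            gcongr
            exact norm_inner_le_norm _ _
      _ = _ := by ring
  have h1 := ((Equiv.prodComm _ _).hasSum_iff.2 hs.hasSum).prod_fiberwise fun j =>
    (h.conj (insertKet (H := H) (stdBasis E j)).adjoint (insertKet (stdBasis E j))).2 v
  have h2 := (hasSum_partialTrace h.isTraceClass).mapL (ContinuousLinearMap.apply ℂ H v)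
  rw [← ContinuousLinearMap.apply_apply v, h2.unique h1]
  exact hs.hasSum

theorem isTraceClass_partialTrace {M : HilbertTensor H E →L[ℂ] HilbertTensor H E}
    (hM : IsTraceClass M) : IsTraceClass (partialTrace M) := by
  obtain ⟨x, y, h⟩ := hM
  exact (HasNuclearRep.partialTrace (x := x) (y := y) h).isTraceClass

/-- `Tr[Tr_E[M] A] = Tr[M (A ⊗ 1)]`. -/
theorem trace_partialTrace_comp {M : HilbertTensor H E →L[ℂ] HilbertTensor H E}
    (hM : IsTraceClass M) (A : H →L[ℂ] H) :
    trace (partialTrace M ∘L A) = trace (M ∘L tensorOp A (.id ℂ E)) := by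
  obtain ⟨x, y, h⟩ := hM
  have h : HasNuclearRep M x y := h
  -- The left side is a sum over pairs `(k, j)`; for fixed `k`, the sum over `j` is Parseval for the
  -- slices of `y k` and `(A ⊗ 1) (x k)`.
  refine HasSum.unique ?_ (h.hasSum_trace_comp (tensorOp A (.id ℂ E)))
  refine (h.partialTrace.hasSum_trace_comp A).prod_fiberwise fun k => ?_
  simpa only [adjoint_insertKet_tensorOp] using
    hasSum_inner_insertKet_adjoint (stdBasis E) (y k) (tensorOp A (.id ℂ E) (x k))

theorem IsTraceClass.conj {K : Type*} [NormedAddCommGroup K] [InnerProductSpace ℂ K]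
    [CompleteSpace K] {T : H →L[ℂ] H} (hT : IsTraceClass T) (A : H →L[ℂ] K) (B : K →L[ℂ] H) :
    IsTraceClass (A ∘L T ∘L B) := by
  obtain ⟨x, y, hT⟩ := hT
  exact (HasNuclearRep.conj (x := x) (y := y) hT A B).isTraceClass

theorem partialTrace_add {M N : HilbertTensor H E →L[ℂ] HilbertTensor H E}
    (hM : IsTraceClass M) (hN : IsTraceClass N) :
    partialTrace (M + N) = partialTrace M + partialTrace N := by
  refine (hasSum_partialTrace (hM.add hN)).unique ?_
  simpa using (hasSum_partialTrace hM).add (hasSum_partialTrace hN)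

theorem partialTrace_smul (c : ℂ) {M : HilbertTensor H E →L[ℂ] HilbertTensor H E}
    (hM : IsTraceClass M) : partialTrace (c • M) = c • partialTrace M := by
  refine (hasSum_partialTrace (hM.smul c)).unique ?_
  simpa using (hasSum_partialTrace hM).const_smul c

end PartialTrace

/-! ### Dilations: adjoint map and complete positivity -/

section Dilation

variable {H E : Type*} [NormedAddCommGroup H] [InnerProductSpace ℂ H] [CompleteSpace H]
  [NormedAddCommGroup E] [InnerProductSpace ℂ E]

/-- The slice map `B ↦ ∑ₗ (1 ⊗ ⟨vₗ|) B (1 ⊗ |uₗ⟩)`, which is `B ↦ Tr_E[(1 ⊗ ρ) B]` for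
`ρ = ∑ₗ |uₗ⟩⟨vₗ|`. -/
noncomputable def slice (u v : ℕ → E) (B : HilbertTensor H E →L[ℂ] HilbertTensor H E) : H →L[ℂ] H :=
  ∑' l, (insertKet (H := H) (v l)).adjoint ∘L B ∘L insertKet (u l)

theorem hasSum_slice {u v : ℕ → E} (h : Summable fun l => ‖u l‖ * ‖v l‖)
    (B : HilbertTensor H E →L[ℂ] HilbertTensor H E) :
    HasSum (fun l => (insertKet (H := H) (v l)).adjoint ∘L B ∘L insertKet (u l))
      (slice u v B) := by
  refine (Summable.of_norm ?_).hasSum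
  refine Summable.of_nonneg_of_le (fun _ => norm_nonneg _) (fun l => ?_) (h.mul_left ‖B‖)
  calc _ ≤ ‖(insertKet (H := H) (v l)).adjoint‖ *
        (‖B‖ * ‖(insertKet (u l) : H →L[ℂ] HilbertTensor H E)‖) :=
        (ContinuousLinearMap.opNorm_comp_le _ _).trans
          (mul_le_mul_of_nonneg_left (ContinuousLinearMap.opNorm_comp_le _ _) (norm_nonneg _))
    _ ≤ ‖v l‖ * (‖B‖ * ‖u l‖) := by
        gcongr
        · rw [LinearIsometryEquiv.norm_map]
          exact norm_insertKet_le _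
        · exact norm_insertKet_le _
    _ = _ := by ring

/-- The summands are `⟪y ⊗ v, B (x ⊗ u)⟫ = ⟪y, (1 ⊗ ⟨v|) B (1 ⊗ |u⟩) x⟫`; summing over the
environment index first produces the slice map. -/
theorem trace_tensorOp_comp {R : E →L[ℂ] E} {u v : ℕ → E} (hR : HasNuclearRep R u v)
    {T : H →L[ℂ] H} (hT : IsTraceClass T) (B : HilbertTensor H E →L[ℂ] HilbertTensor H E) :
    trace (tensorOp T R ∘L B) = trace (T ∘L slice u v B) := by
  obtain ⟨x, y, h⟩ := hT
  have h : HasNuclearRep T x y := h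
  refine HasSum.unique ?_ (h.hasSum_trace_comp (slice u v B))
  refine ((h.tensorOp hR).hasSum_trace_comp B).prod_fiberwise fun k => ?_
  have := (hasSum_slice hR.1 B).mapL ((innerSL ℂ (y k)) ∘L ContinuousLinearMap.apply ℂ H (x k))
  simpa [ContinuousLinearMap.adjoint_inner_right] using this

variable [CompleteSpace E]

theorem isTraceClass_dilation (U : HilbertTensor H E ≃ₗᵢ[ℂ] HilbertTensor H E)
    (ρE : traceClass E) (T : traceClass H) :
    IsTraceClass (unitaryOp U ∘L tensorOp (T : H →L[ℂ] H) (ρE : E →L[ℂ] E) ∘L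
      (unitaryOp U).adjoint) :=
  (isTraceClass_tensorOp T.2 ρE.2).conj _ _

/-- The formula `T ↦ Tr_E [U (T ⊗ ρE) U†]` defines a linear map on the trace class operators. -/
theorem exists_isDilation (U : HilbertTensor H E ≃ₗᵢ[ℂ] HilbertTensor H E)
    (ρE : traceClass E) : ∃ Φ : traceClass H →ₗ[ℂ] traceClass H, IsDilation U ρE Φ := by
  refine ⟨{ toFun := fun T => ⟨_, isTraceClass_partialTrace (isTraceClass_dilation U ρE T)⟩
            map_add' := fun S T => Subtype.ext ?_
            map_smul' := fun c T => Subtype.ext ?_ }, fun T => rfl⟩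
  · simp only [Submodule.coe_add, tensorOp_add_left, ContinuousLinearMap.add_comp,
      ContinuousLinearMap.comp_add]
    exact partialTrace_add (isTraceClass_dilation U ρE S) (isTraceClass_dilation U ρE T)
  · simp only [Submodule.coe_smul, tensorOp_smul_left, ContinuousLinearMap.smul_comp,
      ContinuousLinearMap.comp_smul]
    exact partialTrace_smul c (isTraceClass_dilation U ρE T)

/-- Each term is the scalar `⟪v l, C (u l)⟫` times `A`, and these scalars sum to `Tr[R C]`. -/
theorem slice_tensorOp {R : E →L[ℂ] E} {u v : ℕ → E} (hR : HasNuclearRep R u v)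
    (A : H →L[ℂ] H) (C : E →L[ℂ] E) :
    slice u v (tensorOp A C) = trace (R ∘L C) • A := by
  have h2 : ∀ l, (insertKet (H := H) (v l)).adjoint ∘L tensorOp A C ∘L insertKet (u l) =
      ⟪v l, C (u l)⟫_ℂ • A := fun l => by
    ext a
    refine ext_inner_left ℂ fun b => ?_
    simp [ContinuousLinearMap.adjoint_inner_right, tensorOp_insertKet, inner_insertKet,
      inner_smul_right, mul_comm]
  have h1 := hasSum_slice hR.1 (tensorOp A C)
  simp only [h2] at h1
  exact h1.unique ((hR.hasSum_trace_comp C).smul_const A)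

theorem adjoint_comp_unitaryOp {K : Type*} [NormedAddCommGroup K] [InnerProductSpace ℂ K]
    [CompleteSpace K] (U : K ≃ₗᵢ[ℂ] K) : (unitaryOp U).adjoint ∘L unitaryOp U = .id ℂ K := by
  ext v
  refine ext_inner_left ℂ fun w => ?_
  simp [unitaryOp]

/-- The adjoint of a map with a dilation. -/
theorem IsDilation.exists_isAdjointMap {U : HilbertTensor H E ≃ₗᵢ[ℂ] HilbertTensor H E}
    {ρE : traceClass E} {Φ : traceClass H →ₗ[ℂ] traceClass H} (hΦ : IsDilation U ρE Φ) :
    ∃ Ψ : (H →L[ℂ] H) →ₗ[ℂ] (H →L[ℂ] H), IsAdjointMap Φ Ψ ∧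
      ∀ (A A' : H →L[ℂ] H) (C : E →L[ℂ] E) (c : ℂ),
        (unitaryOp U).adjoint ∘L tensorOp A (.id ℂ E) ∘L unitaryOp U = c • tensorOp A' C →
          Ψ A = (c * trace ((ρE : E →L[ℂ] E) ∘L C)) • A' := by
  obtain ⟨u, v, hR⟩ := ρE.2
  have hR : HasNuclearRep (ρE : E →L[ℂ] E) u v := hR
  have hadd : ∀ B C : HilbertTensor H E →L[ℂ] HilbertTensor H E,
      slice u v (B + C) = slice u v B + slice u v C := fun B C => by
    refine (hasSum_slice hR.1 (B + C)).unique ?_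
    simpa using (hasSum_slice hR.1 B).add (hasSum_slice hR.1 C)
  have hsmul : ∀ (c : ℂ) (B : HilbertTensor H E →L[ℂ] HilbertTensor H E),
      slice u v (c • B) = c • slice u v B := fun c B => by
    refine (hasSum_slice hR.1 (c • B)).unique ?_
    simpa using (hasSum_slice hR.1 B).const_smul c
  -- The witness is `A ↦ Tr_E[(1 ⊗ ρE) U†(A ⊗ 1)U]`, with the partial trace written through a
  -- nuclear series of `ρE`.
  refine ⟨{ toFun := fun A =>
              slice u v ((unitaryOp U).adjoint ∘L tensorOp A (.id ℂ E) ∘L unitaryOp U)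
            map_add' := fun A B => ?_
            map_smul' := fun c A => ?_ }, fun T A => ?_, fun A A' C c h => ?_⟩
  · simp only [tensorOp_add_left, ContinuousLinearMap.add_comp, ContinuousLinearMap.comp_add, hadd]
  · simp only [tensorOp_smul_left, ContinuousLinearMap.smul_comp, ContinuousLinearMap.comp_smul,
      hsmul, RingHom.id_apply]
  · rw [hΦ T, trace_partialTrace_comp (isTraceClass_dilation U ρE T),
      trace_conj_comp (isTraceClass_tensorOp T.2 ρE.2), trace_tensorOp_comp hR T.2]
    rfl
  · change slice u v ((unitaryOp U).adjoint ∘L tensorOp A (.id ℂ E) ∘L unitaryOp U) = _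
    rw [h, hsmul, slice_tensorOp hR, smul_smul]

theorem IsAdjointMap.isTracePreserving {Φ : traceClass H →ₗ[ℂ] traceClass H}
    {Ψ : (H →L[ℂ] H) →ₗ[ℂ] (H →L[ℂ] H)} (h : IsAdjointMap Φ Ψ)
    (h1 : Ψ (.id ℂ H) = .id ℂ H) : IsTracePreserving Φ := fun T => by
  simpa [h1] using h T (.id ℂ H)

/-- If a block operator `T` and `R` are positive, then so is the block operator `T ⊗ R`. -/
theorem sum_inner_tensorOp_nonneg {d : ℕ} {T : Fin d → Fin d → H →L[ℂ] H}
    (hT : ∀ v : Fin d → H, 0 ≤ ∑ i, ∑ j, ⟪v i, T i j (v j)⟫_ℂ) {R : E →L[ℂ] E}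
    (hR : R.IsPositive) (z : Fin d → HilbertTensor H E) :
    0 ≤ ∑ i, ∑ j, ⟪z i, tensorOp (T i j) R (z j)⟫_ℂ := by
  -- With `R = Q†Q`, `T i j ⊗ R` is `T i j ⊗ 1` conjugated by `W = 1 ⊗ Q`, leaving only the case of
  -- the identity.
  obtain ⟨Q, rfl⟩ := CStarAlgebra.nonneg_iff_eq_star_mul_self.1
    ((ContinuousLinearMap.nonneg_iff_isPositive R).2 hR)
  set W : HilbertTensor H E →L[ℂ] HilbertTensor H E := tensorOp (.id ℂ H) Q
  have h1 : ∀ i j, ⟪z i, tensorOp (T i j) (star Q * Q) (z j)⟫_ℂ =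
      ⟪W (z i), tensorOp (T i j) (.id ℂ E) (W (z j))⟫_ℂ := fun i j => by
    rw [← ContinuousLinearMap.adjoint_inner_right]
    congr 1
    have : tensorOp (T i j) (star Q * Q) =
        W.adjoint ∘L tensorOp (T i j) (.id ℂ E) ∘L W := by
      have hid : (ContinuousLinearMap.id ℂ H).adjoint = .id ℂ H := star_one (H →L[ℂ] H)
      simp only [W, adjoint_tensorOp, tensorOp_comp, hid, ContinuousLinearMap.id_comp,
        ContinuousLinearMap.comp_id]
      rfl
    rw [this]
    rfl
  simp only [h1]
  -- Slicing `W (z i)` along a basis of `E` writes the form as a sum over `k` of values of the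
  -- positive form of `T` on the `k`-th slices.
  have h2 := hasSum_sum (s := Finset.univ) fun i _ => hasSum_sum (s := Finset.univ) fun j _ =>
    hasSum_inner_insertKet_adjoint (stdBasis E) (W (z i)) (tensorOp (T i j) (.id ℂ E) (W (z j)))
  simp only [adjoint_insertKet_tensorOp] at h2
  exact h2.nonneg fun k => hT _

/-- The `k`-th term of the partial trace evaluates the block form of `T ⊗ ρE` at the vectors `U†(v i
⊗ |k⟩)`, which is nonnegative. -/
theorem IsDilation.isCompletelyPositive {U : HilbertTensor H E ≃ₗᵢ[ℂ] HilbertTensor H E}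
    {ρE : traceClass E} (hρ : (ρE : E →L[ℂ] E).IsPositive)
    {Φ : traceClass H →ₗ[ℂ] traceClass H} (hΦ : IsDilation U ρE Φ) :
    IsCompletelyPositive Φ := by
  intro d T hT v
  have h2 := hasSum_sum (s := Finset.univ) fun i _ => hasSum_sum (s := Finset.univ) fun j _ =>
    (hasSum_partialTrace (isTraceClass_dilation U ρE (T i j))).mapL
      ((innerSL ℂ (v i)) ∘L ContinuousLinearMap.apply ℂ H (v j))
  simp only [← hΦ (T _ _)] at h2
  refine h2.nonneg fun k => ?_
  have := sum_inner_tensorOp_nonneg hT hρ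
    fun i => (unitaryOp U).adjoint (insertKet (stdBasis E k) (v i))
  simpa [ContinuousLinearMap.adjoint_inner_right, ContinuousLinearMap.adjoint_inner_left]
    using this

end Dilation

end Bosonic

/-! ### Gaussian dilations and displacement operators -/

namespace Bosonic

theorem displacement_zero (n : ℕ) : displacement (0 : Phase n) = .id ℂ (Modes n) := by
  ext1 ψ
  refine Lp.ext ?_
  filter_upwards [displacement_apply_ae 0 ψ] with x hx
  rw [hx]
  simp [weylPhase]

section GaussianDilation

variable {n m : ℕ}
  {U : HilbertTensor (Modes n) (Modes m) ≃ₗᵢ[ℂ] HilbertTensor (Modes n) (Modes m)}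
  {S : (Phase n × Phase m) ≃ₗ[ℝ] (Phase n × Phase m)} {d : Phase n × Phase m}
  {ρE : traceClass (Modes m)} {Φ : traceClass (Modes n) →ₗ[ℂ] traceClass (Modes n)}

/-- A Gaussian unitary dilation acts on the displacement operators by `S₁₁`. -/
theorem IsDilation.isLinearBosonicWith (hU : IsGaussianUnitary U S d) (hρ : IsState ρE)
    (hΦ : IsDilation U ρE Φ) :
    IsLinearBosonicWith Φ (block₁₁ S) fun ξ =>
      Complex.exp ((sympl₂ d (ξ, 0) : ℂ) * Complex.I) * charFn (block₂₁ S ξ) ρE := by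
  obtain ⟨Ψ, hΨ, h⟩ := hΦ.exists_isAdjointMap
  refine ⟨⟨hΦ.isCompletelyPositive hρ.1, hΨ.isTracePreserving ?_⟩, Ψ, hΨ, fun ξ => ?_⟩
  · rw [h (.id ℂ _) (.id ℂ _) (.id ℂ _) 1 (by
      rw [tensorOp_id, ContinuousLinearMap.id_comp, adjoint_comp_unitaryOp, one_smul]),
      ContinuousLinearMap.comp_id, hρ.2, one_mul, one_smul]
  · refine h _ _ _ _ ?_
    -- Since `D(0) = 1`, the operator `D(ξ) ⊗ 1` is `D(ξ, 0)`, and the components of `S⁻¹(ξ, 0)` are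
    -- the two blocks by definition.
    have := hU.2 (ξ, 0)
    rw [displacement₂, displacement_zero] at this
    exact this

/-- This is the adjoint relation tested on `A = D(ξ)`. -/
theorem IsLinearBosonicWith.charFn_eq {X : Phase n →ₗ[ℝ] Phase n} {f : Phase n → ℂ}
    (h : IsLinearBosonicWith Φ X f) (ρ : traceClass (Modes n)) (ξ : Phase n) :
    charFn ξ (Φ ρ) = charFn (X ξ) ρ * f ξ := by
  obtain ⟨_, Ψ, hΨ, hD⟩ := h
  obtain ⟨x, y, hρ⟩ := ρ.2
  have hρ : HasNuclearRep (ρ : Modes n →L[ℂ] Modes n) x y := hρ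
  rw [charFn, hΨ, hD, charFn, mul_comm]
  refine (hρ.hasSum_trace_comp _).unique ?_
  simpa [inner_smul_right] using (hρ.hasSum_trace_comp (displacement (X ξ))).mul_left (f ξ)

theorem IsGaussianDilatable.isLinearBosonic (h : IsGaussianDilatable Φ) : IsLinearBosonic Φ := by
  obtain ⟨m, U, S, d, ρE, hU, hρ, hΦ⟩ := h
  exact ⟨_, _, hΦ.isLinearBosonicWith hU hρ⟩

/-- A photon-added Gaussian state is in particular a state, and the dilation admits any environment
state. -/
theorem IsPhotonAddedGaussianChannel.isGaussianDilatable (h : IsPhotonAddedGaussianChannel Φ) :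
    IsGaussianDilatable Φ := by
  obtain ⟨m, U, S, d, ρE, hU, hρ, hΦ⟩ := h
  exact ⟨m, U, S, d, ρE, hU, hρ.1, hΦ⟩

end GaussianDilation

end Bosonic

theorem mainTheorem9 (n : ℕ) :
    (∀ (m : ℕ)
      (U : Bosonic.HilbertTensor (Bosonic.Modes n) (Bosonic.Modes m) ≃ₗᵢ[ℂ]
        Bosonic.HilbertTensor (Bosonic.Modes n) (Bosonic.Modes m))
      (S : (Bosonic.Phase n × Bosonic.Phase m) ≃ₗ[ℝ] (Bosonic.Phase n × Bosonic.Phase m))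
      (ρE : Bosonic.traceClass (Bosonic.Modes m)),
      Bosonic.IsGaussianUnitary U S 0 → Bosonic.IsState ρE →
        (∃ Φ, Bosonic.IsDilation U ρE Φ) ∧
        ∀ Φ, Bosonic.IsDilation U ρE Φ →
          (∀ ρ, Bosonic.IsState ρ → ∀ ξ,
            Bosonic.charFn ξ (Φ ρ) =
              Bosonic.charFn (Bosonic.block₁₁ S ξ) ρ * Bosonic.charFn (Bosonic.block₂₁ S ξ) ρE) ∧
          Bosonic.IsLinearBosonicWith Φ (Bosonic.block₁₁ S)
            (fun ξ => Bosonic.charFn (Bosonic.block₂₁ S ξ) ρE)) ∧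
    (∀ Φ : Bosonic.traceClass (Bosonic.Modes n) →ₗ[ℂ] Bosonic.traceClass (Bosonic.Modes n),
      Bosonic.IsGaussianDilatable Φ → Bosonic.IsLinearBosonic Φ) ∧
    (∀ Φ : Bosonic.traceClass (Bosonic.Modes n) →ₗ[ℂ] Bosonic.traceClass (Bosonic.Modes n),
      Bosonic.IsPhotonAddedGaussianChannel Φ →
        Bosonic.IsGaussianDilatable Φ ∧ Bosonic.IsLinearBosonic Φ) := by
  refine ⟨fun m U S ρE hU hρ => ⟨Bosonic.exists_isDilation U ρE, fun Φ hΦ => ?_⟩,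
    fun Φ h => h.isLinearBosonic, fun Φ h => ⟨h.isGaussianDilatable,
      h.isGaussianDilatable.isLinearBosonic⟩⟩
  have h : Bosonic.IsLinearBosonicWith Φ (Bosonic.block₁₁ S)
      fun ξ => Bosonic.charFn (Bosonic.block₂₁ S ξ) ρE := by
    -- For `d = 0` the symplectic form vanishes and the phase factor is `1`.
    simpa [Bosonic.sympl₂, Bosonic.sympl] using hΦ.isLinearBosonicWith hU hρ
  exact ⟨fun ρ _ ξ => h.charFn_eq ρ ξ, h⟩
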